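/- **Model.** Let $N\ge 1$ and let $f:[N]\to\{0,1,2\}$ be the input, accessible only through oracle gates. Write $n=\lceil\log_2 N\rceil$. A quantum circuit of space $S$ acts on a memory of $S$ qubits, initially $|0\cdots0\rangle$, and is a fixed finite sequence of gates, each of which is of one of the following kinds. * An oracle gate: for a choice of $n+2$ distinct memory qubits, $n$ of them holding $x$ and two of them holding $p$ in binary, it multiplies the basis state by $\omega^{p f(x)}$ with $\omega=e^{2\pi i/3}$ (basis states whose query register holds no element of $[N]$ are left unchanged). * An arbitrary input-independent quantum operation on the $S$ qubits (in particular any unitary gate, and also intermediate measurements and resets). * An output gate: an input-independent isometry from the memory to the memory together with one fresh output qubit (for instance, copying one memory qubit in the computational basis). The output qubit is not used again and is not counted in $S$. At the end the output qubits are measured in the computational basis and read in the order in which they were written. The positions of the oracle and output gates are predefined. The time $T$ of the circuit is its number of gates, and $Q\le T$ is its number of oracle gates. The circuit sorts with success probability $2/3$ if for every $f:[N]\to\{0,1,2\}$, with probability at least $2/3$, its output is the sequence of the $n$-bit representations of distinct $x_1,\dots,x_N\in[N]$, in this order, such that $f(x_1)\ge f(x_2)\ge\dots\ge f(x_N)$.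 **Theorem.** There is a universal constant $c>0$ such that for all integers $N\ge 2$ and $S \ge 0$, every quantum circuit of space $S$ that sorts functions $f:[N]\to\{0,1,2\}$ with success probability $2/3$ satisfies $$T^2 S\ \ge\ c\,N^3 .$$ The same bound already holds when only oracle gates are counted, that is, $Q^2 S\ge c\,N^3$. -/

import Mathlib

namespace QSort

/-- Computational basis states of a memory of `S` qubits. -/
abbrev Basis (S : ℕ) : Type := Fin S → Bool

/-- Operators on the state space of `S` qubits, in the computational basis. -/
abbrev Op (S : ℕ) : Type := Matrix (Basis S) (Basis S) ℂ

/-- The number of bits used to write an element of `[N]`. -/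
abbrev width (N : ℕ) : ℕ := Nat.clog 2 N

/-- The phase `ω ^ (p * f x)`, with `ω = exp (2πi/3)`, which the oracle of `f : [N] → {0,1,2}`
applies when the query register holds `x` and the phase register holds `p`. Query registers that
do not hold an element of `[N]` are left alone. -/
noncomputable def phase {N : ℕ} (f : Fin N → Fin 3) (x p : ℕ) : ℂ :=
  if h : x < N then
    Complex.exp (2 * (Real.pi : ℂ) * Complex.I / 3) ^ (p * (f ⟨x, h⟩ : ℕ))
  else 1

/-- The oracle gate: `reg` says which (distinct) qubits of the memory hold the query register
(`width N` qubits, an element of `[N]` in binary) and which hold the phase register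
(two qubits, a residue modulo 3 in binary). It multiplies every basis state by its phase. -/
noncomputable def oracleOp {N S : ℕ} (f : Fin N → Fin 3)
    (reg : Fin (width N) ⊕ Fin 2 ↪ Fin S) : Op S :=
  Matrix.diagonal fun b : Basis S =>
    phase f (Nat.ofBits fun i => b (reg (Sum.inl i))) (Nat.ofBits fun i => b (reg (Sum.inr i)))

/-- The gates of a circuit on `S` qubits with oracle access to a function on `[N]`.

* `oracle` is a query to the input.
* `channel` is any input-independent quantum operation on the `S` qubits, given by Kraus operators.
  With a single operator it is an arbitrary unitary gate; measurements and resets of qubits are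
  also covered.
* `output` writes one bit on a fresh output qubit, which is never used again. In general this
  is an isometry from the memory to the memory and the output qubit, `ψ ↦ ∑ b, K b ψ ⊗ |b⟩`.
  When `K b` is the projection onto the states in which qubit `a` equals `b`, it
  copies qubit `a` of the memory to the output. -/
inductive Gate (N S : ℕ) : Type
  | oracle (reg : Fin (width N) ⊕ Fin 2 ↪ Fin S) : Gate N S
  | channel (k : ℕ) (K : Fin k → Op S)
      (hK : ∑ j, (K j).conjTranspose * K j = 1) : Gate N S
  | output (K : Bool → Op S)
      (hK : ∑ b, (K b).conjTranspose * K b = 1) : Gate N S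

/-- A circuit: a fixed finite sequence of gates, in the order in which they are applied. The
oracle and output gates are at predefined places. The space is the number `S` of qubits; output
qubits are not counted. -/
structure Circuit (N S : ℕ) where
  gates : List (Gate N S)

/-- Whether a gate is an oracle gate. -/
def Gate.isOracle {N S : ℕ} : Gate N S → Bool
  | .oracle _ => true
  | _ => false

/-- Whether a gate is an output gate. -/
def Gate.isOutput {N S : ℕ} : Gate N S → Bool
  | .output _ _ => true
  | _ => false

/-- The unnormalised state of the memory after applying a list of gates to the density operator
`ρ`, restricted to the event that the bits written on the output qubits, in order, are `o`. -/
noncomputable def run {N S : ℕ} (f : Fin N → Fin 3) :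
    List (Gate N S) → List Bool → Op S → Op S
  | [], [], ρ => ρ
  | [], _ :: _, _ => 0
  | .oracle reg :: gs, o, ρ =>
      run f gs o (oracleOp f reg * ρ * (oracleOp f reg).conjTranspose)
  | .channel _ K _ :: gs, o, ρ =>
      run f gs o (∑ j, K j * ρ * (K j).conjTranspose)
  | .output _ _ :: _, [], _ => 0
  | .output K _ :: gs, b :: o, ρ =>
      run f gs o (K b * ρ * (K b).conjTranspose)

namespace Circuit

variable {N S : ℕ}

/-- The time: the number of gates. -/
def time (C : Circuit N S) : ℕ := C.gates.length

/-- The number of queries: the number of oracle gates. -/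
def queries (C : Circuit N S) : ℕ := C.gates.countP Gate.isOracle

/-- The number of output bits. -/
def outputs (C : Circuit N S) : ℕ := C.gates.countP Gate.isOutput

/-- The probability that the output is the bit string `o` when the circuit is run on the input
`f`, from the memory state `|0…0⟩`. -/
noncomputable def outputProb (C : Circuit N S) (f : Fin N → Fin 3) (o : List Bool) : ℝ :=
  (run f C.gates o (Matrix.single (fun _ => false) (fun _ => false) 1)).trace.re

end Circuit

/-- The output string that represents the sequence `x`: its terms in order, in binary. -/
def encode {N : ℕ} (x : Fin N → Fin N) : List Bool :=
  (List.ofFn fun i : Fin N =>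
    List.ofFn fun j : Fin (width N) => Nat.testBit (x i) j).flatten

/-- The output string `o` represents a sequence of distinct `x₁, …, x_N ∈ [N]` such that
`f x₁ ≥ f x₂ ≥ … ≥ f x_N`. -/
def IsSorting {N : ℕ} (f : Fin N → Fin 3) (o : List Bool) : Prop :=
  ∃ x : Fin N → Fin N, Function.Injective x ∧ Antitone (f ∘ x) ∧ o = encode x

open Classical in
/-- The probability that the circuit outputs a correct sorting of `f`. -/
noncomputable def Circuit.successProb {N S : ℕ} (C : Circuit N S) (f : Fin N → Fin 3) : ℝ :=
  ∑ o : Fin C.outputs → Bool,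
    if IsSorting f (List.ofFn o) then C.outputProb f (List.ofFn o) else 0

end QSort

/-! The proof bounds what a short slice of the circuit can find. In `hardInput N a g` the elements
of rank `a, …, a + K - 1` are `K` marked points, one hidden in each of `K` groups of size `m`, so a
slice that writes them solves `K` independent search problems at once. With far fewer than `K√m`
queries it does so with probability exponentially small in `K`.

This is proved with a potential. The states for all indices `g` are viewed jointly as a
vector-valued function of `g`, and `energy l` gives weight `l ^ 2` to every coordinate of `g` in
which this function deviates from uniform. Input-independent operations preserve the energy
(`sum_energy_kraus`). A query changes a phase at one value of one coordinate at most, and multiplies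
the energy by at most `1 + 4 (l² - 1) / √m` (`energy_phase_mul_le`). The weight at any single index
is at most `(1 / m + 1 / l²) ^ K` times the energy (`normSq_apply_le`). Together these give
`sum_expect_pure_le`.

The memory left by earlier gates may help the slice, but a density operator is at most the identity,
a sum of `2 ^ S` basis states, so it helps by a factor `2 ^ S` at most (`slice_bound`). For `K = S +
1` the decay in `K` beats this factor. Each slice then needs of order `S√m` queries, and `m ≈ N / (2
(S + 1))` disjoint slices give `Q` of order `N^(3/2) / √S`. When `S` is of order `N`, the first
slice alone, which starts from a fixed state, needs of order `N` queries. -/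

namespace QSort

/-! ### Output expectations, and how to cut a circuit into slices. -/

open Matrix
open scoped ComplexOrder

variable {N S : ℕ}

/-- The expectation of `χ o`, where `o` is the output of a list of gates run from `ρ`. -/
noncomputable def expect (f : Fin N → Fin 3) :
    List (Gate N S) → (List Bool → ℝ) → Op S → ℝ
  | [], χ, ρ => χ [] * ρ.trace.re
  | .oracle reg :: gs, χ, ρ => expect f gs χ (oracleOp f reg * ρ * (oracleOp f reg)ᴴ)
  | .channel _ K _ :: gs, χ, ρ => expect f gs χ (∑ j, K j * ρ * (K j)ᴴ)
  | .output K _ :: gs, χ, ρ =>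
      ∑ b, expect f gs (fun o => χ (b :: o)) (K b * ρ * (K b)ᴴ)

/-- Replaces the sum over output strings of a fixed length by a recursion along the gates, so that
later arguments are inductions on the gate list. -/
theorem sum_run_eq_expect (f : Fin N → Fin 3) (gs : List (Gate N S)) (χ : List Bool → ℝ)
    (ρ : Op S) (n : ℕ) (hn : gs.countP Gate.isOutput = n) :
    ∑ o : Fin n → Bool, χ (List.ofFn o) * (run f gs (List.ofFn o) ρ).trace.re =
      expect f gs χ ρ := by
  induction gs generalizing χ ρ n with
  | nil =>
    simp only [List.countP_nil] at hn
    subst hn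
    simp [run, expect]
  | cons g gs ih =>
    cases g with
    | oracle reg =>
      simp only [run, expect]
      exact ih χ _ n (by simpa [List.countP_cons, Gate.isOutput] using hn)
    | channel k K hK =>
      simp only [run, expect]
      exact ih χ _ n (by simpa [List.countP_cons, Gate.isOutput] using hn)
    | output K hK =>
      obtain ⟨n, rfl⟩ : ∃ k, n = k + 1 := by
        simp [List.countP_cons, Gate.isOutput] at hn; exact ⟨_, hn.symm⟩
      rw [← Equiv.sum_comp (Fin.consEquiv fun _ : Fin (n + 1) => Bool),
        Fintype.sum_prod_type]
      simp only [expect]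
      refine Finset.sum_congr rfl fun b _ => ?_
      rw [← ih (fun o => χ (b :: o)) _ n
        (by simpa [List.countP_cons, Gate.isOutput] using hn)]
      refine Finset.sum_congr rfl fun o _ => ?_
      simp [Fin.consEquiv, List.ofFn_succ, run]

open Classical in
/-- The indicator function of a property of bit strings. -/
noncomputable def indic (p : List Bool → Prop) (o : List Bool) : ℝ := if p o then 1 else 0

theorem successProb_eq_expect (C : Circuit N S) (f : Fin N → Fin 3) :
    C.successProb f = expect f C.gates (indic (IsSorting f))
      (Matrix.single (fun _ => false) (fun _ => false) 1) := by
  rw [← sum_run_eq_expect f C.gates _ _ C.outputs rfl]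
  unfold Circuit.successProb Circuit.outputProb indic
  refine Finset.sum_congr rfl fun o _ => ?_
  split_ifs <;> simp

theorem expect_add (f : Fin N → Fin 3) (gs : List (Gate N S)) (χ : List Bool → ℝ)
    (ρ σ : Op S) : expect f gs χ (ρ + σ) = expect f gs χ ρ + expect f gs χ σ := by
  induction gs generalizing χ ρ σ with
  | nil => simp [expect, mul_add]
  | cons g gs ih =>
    cases g <;>
      simp only [expect, mul_add, add_mul, Finset.sum_add_distrib, ih]

theorem expect_zero (f : Fin N → Fin 3) (gs : List (Gate N S)) (χ : List Bool → ℝ) :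
    expect f gs χ (0 : Op S) = 0 := by
  have := expect_add f gs χ (0 : Op S) 0
  rw [add_zero] at this
  linarith

theorem expect_sum {α : Type*} (f : Fin N → Fin 3) (gs : List (Gate N S)) (χ : List Bool → ℝ)
    (s : Finset α) (ρ : α → Op S) :
    expect f gs χ (∑ i ∈ s, ρ i) = ∑ i ∈ s, expect f gs χ (ρ i) := by
  classical
  induction s using Finset.induction_on with
  | empty => simp [expect_zero]
  | insert i s hi ih => rw [Finset.sum_insert hi, Finset.sum_insert hi, expect_add, ih]

theorem expect_mono (f : Fin N → Fin 3) (gs : List (Gate N S)) {χ χ' : List Bool → ℝ}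
    (h : ∀ o, χ o ≤ χ' o) {ρ : Op S} (hρ : ρ.PosSemidef) :
    expect f gs χ ρ ≤ expect f gs χ' ρ := by
  induction gs generalizing χ χ' ρ with
  | nil =>
    exact mul_le_mul_of_nonneg_right (h _) (Complex.nonneg_iff.1 hρ.trace_nonneg).1
  | cons g gs ih =>
    cases g with
    | oracle reg => exact ih h (hρ.mul_mul_conjTranspose_same _)
    | channel k K hK =>
      exact ih h (Matrix.posSemidef_sum _ fun j _ => hρ.mul_mul_conjTranspose_same _)
    | output K hK =>
      exact Finset.sum_le_sum fun b _ =>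
        ih (fun o => h (b :: o)) (hρ.mul_mul_conjTranspose_same _)

theorem expect_nonneg (f : Fin N → Fin 3) (gs : List (Gate N S)) {χ : List Bool → ℝ}
    (h : ∀ o, 0 ≤ χ o) {ρ : Op S} (hρ : ρ.PosSemidef) : 0 ≤ expect f gs χ ρ := by
  induction gs generalizing χ ρ with
  | nil => exact mul_nonneg (h _) (Complex.nonneg_iff.1 hρ.trace_nonneg).1
  | cons g gs ih =>
    cases g with
    | oracle reg => exact ih h (hρ.mul_mul_conjTranspose_same _)
    | channel k K hK =>
      exact ih h (Matrix.posSemidef_sum _ fun j _ => hρ.mul_mul_conjTranspose_same _)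
    | output K hK =>
      exact Finset.sum_nonneg fun b _ =>
        ih (fun o => h (b :: o)) (hρ.mul_mul_conjTranspose_same _)

theorem trace_sum_kraus {k : Type*} [Fintype k] (K : k → Op S) (hK : ∑ j, (K j)ᴴ * K j = 1)
    (ρ : Op S) : (∑ j, K j * ρ * (K j)ᴴ).trace = ρ.trace := by
  rw [Matrix.trace_sum, Finset.sum_congr rfl fun j _ => Matrix.trace_mul_cycle (K j) ρ (K j)ᴴ,
    ← Matrix.trace_sum, ← Finset.sum_mul, hK, one_mul]

theorem norm_phase (f : Fin N → Fin 3) (x p : ℕ) : ‖phase f x p‖ = 1 := by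
  unfold phase
  split_ifs
  · rw [norm_pow, show (2 * (Real.pi : ℂ) * Complex.I / 3) =
      ((2 * Real.pi / 3 : ℝ) : ℂ) * Complex.I by push_cast; ring,
      Complex.norm_exp_ofReal_mul_I, one_pow]
  · simp

theorem oracleOp_conjTranspose_mul (f : Fin N → Fin 3)
    (reg : Fin (width N) ⊕ Fin 2 ↪ Fin S) : (oracleOp f reg)ᴴ * oracleOp f reg = 1 := by
  unfold oracleOp
  rw [Matrix.diagonal_conjTranspose, Matrix.diagonal_mul_diagonal, ← Matrix.diagonal_one]
  congr 1
  ext b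
  rw [Pi.star_apply, Complex.star_def, ← Complex.normSq_eq_conj_mul_self,
    Complex.normSq_eq_norm_sq, norm_phase]
  simp

theorem trace_oracle (f : Fin N → Fin 3) (reg : Fin (width N) ⊕ Fin 2 ↪ Fin S) (ρ : Op S) :
    (oracleOp f reg * ρ * (oracleOp f reg)ᴴ).trace = ρ.trace := by
  rw [Matrix.trace_mul_cycle, oracleOp_conjTranspose_mul, one_mul]

theorem expect_const (f : Fin N → Fin 3) (gs : List (Gate N S)) (c : ℝ) (ρ : Op S) :
    expect f gs (fun _ => c) ρ = c * ρ.trace.re := by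
  induction gs generalizing ρ with
  | nil => rfl
  | cons g gs ih =>
    cases g with
    | oracle reg => rw [expect, ih, trace_oracle]
    | channel k K hK => rw [expect, ih, trace_sum_kraus K hK]
    | output K hK =>
      simp_rw [expect, ih]
      rw [← Finset.mul_sum, ← Complex.re_sum, ← Matrix.trace_sum, trace_sum_kraus K hK]

/-- Lets the gates after a slice be dropped: they preserve the trace, and the test is relaxed to one
on the earlier bits only. -/
theorem expect_append_le (f : Fin N → Fin 3) (gs hs : List (Gate N S)) {χ χ' : List Bool → ℝ}
    (h : ∀ o₁ o₂ : List Bool, o₁.length = gs.countP Gate.isOutput → χ (o₁ ++ o₂) ≤ χ' o₁)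
    {ρ : Op S} (hρ : ρ.PosSemidef) :
    expect f (gs ++ hs) χ ρ ≤ expect f gs χ' ρ := by
  induction gs generalizing χ χ' ρ with
  | nil =>
    calc expect f hs χ ρ ≤ expect f hs (fun _ => χ' []) ρ :=
          expect_mono f hs (fun o => h [] o rfl) hρ
      _ = _ := expect_const f hs _ ρ
  | cons g gs ih =>
    cases g with
    | oracle reg =>
      exact ih (by simpa [List.countP_cons, Gate.isOutput] using h)
        (hρ.mul_mul_conjTranspose_same _)
    | channel k K hK =>
      exact ih (by simpa [List.countP_cons, Gate.isOutput] using h)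
        (Matrix.posSemidef_sum _ fun j _ => hρ.mul_mul_conjTranspose_same _)
    | output K hK =>
      exact Finset.sum_le_sum fun b _ => ih
        (fun o₁ o₂ h₁ => h (b :: o₁) o₂ (by simp [List.countP_cons, Gate.isOutput, h₁]))
        (hρ.mul_mul_conjTranspose_same _)

/-- The state of the memory after a list of gates, whatever the output is. -/
noncomputable def evolve (f : Fin N → Fin 3) : List (Gate N S) → Op S → Op S
  | [], ρ => ρ
  | .oracle reg :: gs, ρ => evolve f gs (oracleOp f reg * ρ * (oracleOp f reg)ᴴ)
  | .channel _ K _ :: gs, ρ => evolve f gs (∑ j, K j * ρ * (K j)ᴴ)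
  | .output K _ :: gs, ρ => evolve f gs (∑ b, K b * ρ * (K b)ᴴ)

theorem posSemidef_evolve (f : Fin N → Fin 3) (gs : List (Gate N S)) {ρ : Op S}
    (hρ : ρ.PosSemidef) : (evolve f gs ρ).PosSemidef := by
  induction gs generalizing ρ with
  | nil => exact hρ
  | cons g gs ih =>
    cases g with
    | oracle reg => exact ih (hρ.mul_mul_conjTranspose_same _)
    | channel k K hK =>
      exact ih (Matrix.posSemidef_sum _ fun j _ => hρ.mul_mul_conjTranspose_same _)
    | output K hK =>
      exact ih (Matrix.posSemidef_sum _ fun j _ => hρ.mul_mul_conjTranspose_same _)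

theorem trace_evolve (f : Fin N → Fin 3) (gs : List (Gate N S)) (ρ : Op S) :
    (evolve f gs ρ).trace = ρ.trace := by
  induction gs generalizing ρ with
  | nil => rfl
  | cons g gs ih =>
    cases g with
    | oracle reg => rw [evolve, ih, trace_oracle]
    | channel k K hK => rw [evolve, ih, trace_sum_kraus K hK]
    | output K hK => rw [evolve, ih, trace_sum_kraus K hK]

theorem evolve_add (f : Fin N → Fin 3) (gs : List (Gate N S)) (ρ σ : Op S) :
    evolve f gs (ρ + σ) = evolve f gs ρ + evolve f gs σ := by
  induction gs generalizing ρ σ with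
  | nil => rfl
  | cons g gs ih =>
    cases g <;>
      simp only [evolve, mul_add, add_mul, Finset.sum_add_distrib, ih]

/-- Lets the gates before a slice be dropped: once the test no longer depends on their output, they
matter only through the memory state that they leave. -/
theorem expect_append_le_evolve (f : Fin N → Fin 3) (gs hs : List (Gate N S))
    {χ χ' : List Bool → ℝ}
    (h : ∀ o₁ o₂ : List Bool, o₁.length = gs.countP Gate.isOutput → χ (o₁ ++ o₂) ≤ χ' o₂)
    {ρ : Op S} (hρ : ρ.PosSemidef) :
    expect f (gs ++ hs) χ ρ ≤ expect f hs χ' (evolve f gs ρ) := by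
  induction gs generalizing χ ρ with
  | nil => exact expect_mono f hs (fun o => h [] o rfl) hρ
  | cons g gs ih =>
    cases g with
    | oracle reg =>
      exact ih (by simpa [List.countP_cons, Gate.isOutput] using h)
        (hρ.mul_mul_conjTranspose_same _)
    | channel k K hK =>
      exact ih (by simpa [List.countP_cons, Gate.isOutput] using h)
        (Matrix.posSemidef_sum _ fun j _ => hρ.mul_mul_conjTranspose_same _)
    | output K hK =>
      simp only [List.cons_append, expect, evolve]
      rw [Fintype.sum_bool, Fintype.sum_bool, evolve_add, expect_add]
      exact add_le_add
        (ih (fun o₁ o₂ h₁ => h (true :: o₁) o₂ (by simp [List.countP_cons, Gate.isOutput, h₁]))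
          (hρ.mul_mul_conjTranspose_same _))
        (ih (fun o₁ o₂ h₁ => h (false :: o₁) o₂ (by simp [List.countP_cons, Gate.isOutput, h₁]))
          (hρ.mul_mul_conjTranspose_same _))

/-- The eigenvalues are nonnegative with sum `1`, so each is at most `1`. -/
theorem posSemidef_one_sub {n : Type*} [Fintype n] [DecidableEq n] {ρ : Matrix n n ℂ}
    (hρ : ρ.PosSemidef) (htr : ρ.trace = 1) : (1 - ρ).PosSemidef := by
  have hspec := hρ.isHermitian.spectral_theorem
  have hsum : ∑ i, hρ.isHermitian.eigenvalues i = 1 := by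
    have := hρ.isHermitian.trace_eq_sum_eigenvalues
    rw [htr] at this
    rw [← Complex.ofReal_inj, Complex.ofReal_sum, Complex.ofReal_one]
    exact this.symm
  have hle : ∀ i, hρ.isHermitian.eigenvalues i ≤ 1 := fun i => by
    rw [← hsum]
    exact Finset.single_le_sum (fun j _ => hρ.eigenvalues_nonneg j) (Finset.mem_univ i)
  set U : Matrix n n ℂ := (hρ.isHermitian.eigenvectorUnitary : Matrix n n ℂ)
  have hU : U * Uᴴ = 1 := Unitary.mul_star_self_of_mem hρ.isHermitian.eigenvectorUnitary.2
  have e : 1 - ρ = U * Matrix.diagonal (fun i => ((1 - hρ.isHermitian.eigenvalues i : ℝ) : ℂ)) *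
      Uᴴ := by
    have hd : Matrix.diagonal (fun i => ((1 - hρ.isHermitian.eigenvalues i : ℝ) : ℂ)) =
        1 - Matrix.diagonal (fun i => ((hρ.isHermitian.eigenvalues i : ℝ) : ℂ)) := by
      rw [← Matrix.diagonal_one, Matrix.diagonal_sub]
      simp
    rw [hd, mul_sub, sub_mul, mul_one, hU]
    congr 1
  rw [e]
  refine Matrix.PosSemidef.mul_mul_conjTranspose_same (Matrix.PosSemidef.diagonal ?_) U
  intro i
  simp only [Pi.zero_apply]
  exact_mod_cast sub_nonneg.2 (hle i)

/-- A density operator is at most the sum of all basis states. -/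
theorem expect_le_sum_basis (f : Fin N → Fin 3) (gs : List (Gate N S)) {χ : List Bool → ℝ}
    (h : ∀ o, 0 ≤ χ o) {ρ : Op S} (hρ : ρ.PosSemidef) (htr : ρ.trace = 1) :
    expect f gs χ ρ ≤ ∑ b : Basis S, expect f gs χ (Matrix.single b b 1) := by
  have hone : (1 : Op S) = ∑ b : Basis S, Matrix.single b b 1 := by
    rw [← Matrix.diagonal_one, ← Matrix.sum_single_eq_diagonal]
  rw [← expect_sum, ← hone, ← add_sub_cancel ρ 1, expect_add]
  linarith [expect_nonneg f gs h (posSemidef_one_sub hρ htr)]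

theorem single_eq_vecMulVec (b : Basis S) :
    (Matrix.single b b 1 : Op S) = vecMulVec (Pi.single b 1) (star (Pi.single b 1)) := by
  rw [Pi.star_single, star_one, Matrix.single_eq_single_vecMulVec_single]

theorem posSemidef_single (b : Basis S) : (Matrix.single b b 1 : Op S).PosSemidef := by
  rw [single_eq_vecMulVec]
  exact posSemidef_vecMulVec_self_star _

theorem conj_vecMulVec (K : Op S) (ψ : Basis S → ℂ) :
    K * vecMulVec ψ (star ψ) * Kᴴ = vecMulVec (K *ᵥ ψ) (star (K *ᵥ ψ)) := by
  rw [mul_vecMulVec, vecMulVec_mul, star_mulVec]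

end QSort

namespace QSort

set_option linter.unusedSectionVars false

/-! ### The weighted energy of a single coordinate. -/

section Register

variable {β : Type*} [Fintype β]

/-- With `P` the averaging projection, this is `‖αw + γPw‖² = α²‖w‖² + (2αγ + γ²)‖Pw‖²`. The choice
`(1, -1)` gives the variance, and `(l, 1 - l)` the energy `l²‖w‖² - (l² - 1)‖Pw‖²`. -/
theorem sum_normSq_add_mean (hβ : 0 < Fintype.card β) (α γ : ℝ) (w : β → ℂ) :
    ∑ a, Complex.normSq (α * w a + γ * ((Fintype.card β : ℂ)⁻¹ * ∑ c, w c)) =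
      α ^ 2 * ∑ a, Complex.normSq (w a) +
        (2 * α * γ + γ ^ 2) * (Complex.normSq (∑ c, w c) / Fintype.card β) := by
  have hm : (Fintype.card β : ℝ) ≠ 0 := by positivity
  set s := ∑ c, w c with hs
  set m : ℝ := (Fintype.card β : ℝ) with hmdef
  have e1 : ∀ a, Complex.normSq (α * w a + γ * ((Fintype.card β : ℂ)⁻¹ * s)) =
      α ^ 2 * Complex.normSq (w a) + γ ^ 2 * Complex.normSq s / m ^ 2 +
        2 * α * γ / m * ((w a).re * s.re + (w a).im * s.im) := by
    intro a
    have : ((Fintype.card β : ℂ)⁻¹ * s) = ((m⁻¹ : ℝ) : ℂ) * s := by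
      simp [hmdef]
    rw [this]
    simp only [Complex.normSq_apply, Complex.add_re, Complex.add_im, Complex.re_ofReal_mul,
      Complex.im_ofReal_mul]
    field_simp
    ring
  simp_rw [e1]
  rw [Finset.sum_add_distrib, Finset.sum_add_distrib, ← Finset.mul_sum, ← Finset.mul_sum,
    Finset.sum_add_distrib, ← Finset.sum_mul, ← Finset.sum_mul, ← Complex.re_sum,
    ← Complex.im_sum, ← hs, Finset.sum_const, Finset.card_univ, nsmul_eq_mul,
    Complex.normSq_apply s]
  field_simp
  ring

theorem normSq_sum_div_card_le (hβ : 0 < Fintype.card β) (w : β → ℂ) :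
    Complex.normSq (∑ c, w c) / Fintype.card β ≤ ∑ a, Complex.normSq (w a) := by
  have h := sum_normSq_add_mean hβ 1 (-1) w
  have h0 : 0 ≤ ∑ a, Complex.normSq
      ((1 : ℝ) * w a + (-1 : ℝ) * ((Fintype.card β : ℂ)⁻¹ * ∑ c, w c)) :=
    Finset.sum_nonneg fun _ _ => Complex.normSq_nonneg _
  rw [h] at h0
  linarith

/-- Changing the phase of one entry changes the weighted energy of a register by little. -/
theorem energy_phase_le [DecidableEq β] (hβ : 0 < Fintype.card β) {l : ℝ} (hl : 1 ≤ l)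
    (w : β → ℂ) (a₀ : β) {z : ℂ} (hz : ‖z‖ = 1) :
    l ^ 2 * ∑ a, Complex.normSq ((if a = a₀ then z else 1) * w a) -
        (l ^ 2 - 1) * (Complex.normSq (∑ a, (if a = a₀ then z else 1) * w a) / Fintype.card β) ≤
      (1 + 4 * (l ^ 2 - 1) / √(Fintype.card β)) *
        (l ^ 2 * ∑ a, Complex.normSq (w a) -
          (l ^ 2 - 1) * (Complex.normSq (∑ a, w a) / Fintype.card β)) := by
  have hW : ∑ a, Complex.normSq ((if a = a₀ then z else 1) * w a) =
      ∑ a, Complex.normSq (w a) := by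
    refine Finset.sum_congr rfl fun a _ => ?_
    rw [map_mul]
    split_ifs <;> simp [Complex.normSq_eq_norm_sq, hz]
  have hs : ∑ a, (if a = a₀ then z else 1) * w a = (∑ a, w a) + (z - 1) * w a₀ := by
    have : ∀ a, (if a = a₀ then z else 1) * w a =
        w a + if a = a₀ then (z - 1) * w a else 0 := by
      intro a; split_ifs <;> ring
    simp_rw [this, Finset.sum_add_distrib]
    simp
  rw [hW, hs]
  have hCS := normSq_sum_div_card_le hβ w
  have hY : Complex.normSq (w a₀) ≤ ∑ a, Complex.normSq (w a) :=
    Finset.single_le_sum (f := fun a => Complex.normSq (w a))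
      (fun _ _ => Complex.normSq_nonneg _) (Finset.mem_univ a₀)
  set W := ∑ a, Complex.normSq (w a)
  set s := ∑ a, w a
  have hm : (0 : ℝ) < Fintype.card β := by exact_mod_cast hβ
  set m : ℝ := (Fintype.card β : ℝ)
  have hz1 : ‖(z - 1) * w a₀‖ ≤ 2 * ‖w a₀‖ := by
    rw [norm_mul]
    gcongr
    calc ‖z - 1‖ ≤ ‖z‖ + ‖(1 : ℂ)‖ := norm_sub_le _ _
      _ = 2 := by rw [hz]; norm_num
  have hs' : ‖s‖ ^ 2 - 4 * ‖s‖ * ‖w a₀‖ ≤ ‖s + (z - 1) * w a₀‖ ^ 2 := by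
    have h1 : ‖s‖ - 2 * ‖w a₀‖ ≤ ‖s + (z - 1) * w a₀‖ := by
      have := norm_sub_le (s + (z - 1) * w a₀) ((z - 1) * w a₀)
      rw [add_sub_cancel_right] at this
      linarith
    rcases le_or_gt (2 * ‖w a₀‖) ‖s‖ with h | h
    · nlinarith [norm_nonneg (w a₀)]
    · nlinarith [norm_nonneg (w a₀), norm_nonneg s, norm_nonneg (s + (z - 1) * w a₀)]
  rw [Complex.normSq_eq_norm_sq] at hCS hY ⊢
  rw [Complex.normSq_eq_norm_sq]
  set X := ‖s‖
  set Y := ‖w a₀‖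
  have hsq : √m ^ 2 = m := Real.sq_sqrt hm.le
  have hsp : 0 < √m := Real.sqrt_pos.2 hm
  have hl2 : 0 ≤ l ^ 2 - 1 := by nlinarith
  -- Both `X² / m` and `Y²` are at most `W`, hence so is the product of `X / √m` and `Y`; and the
  -- energy is at least `W`.
  have hE : X / √m * Y ≤ l ^ 2 * W - (l ^ 2 - 1) * (X ^ 2 / m) := by
    have e : (X / √m) ^ 2 = X ^ 2 / m := by rw [div_pow, hsq]
    have h2 : (l ^ 2 - 1) * (X ^ 2 / m) ≤ (l ^ 2 - 1) * W := by gcongr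
    nlinarith [sq_nonneg (X / √m - Y)]
  have hstep : (l ^ 2 - 1) * (X ^ 2 / m) - (l ^ 2 - 1) * (4 * (X / √m * Y) / √m) ≤
      (l ^ 2 - 1) * (‖s + (z - 1) * w a₀‖ ^ 2 / m) := by
    rw [← mul_sub]
    gcongr
    have : X ^ 2 / m - 4 * (X / √m * Y) / √m = (X ^ 2 - 4 * X * Y) / m := by
      have h : ∀ t : ℝ, t ≠ 0 →
          X ^ 2 / t ^ 2 - 4 * (X / t * Y) / t = (X ^ 2 - 4 * X * Y) / t ^ 2 := by
        intro t ht; field_simp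
      have := h _ hsp.ne'
      rwa [hsq] at this
    rw [this]
    gcongr
  have hfin : (l ^ 2 - 1) * (4 * (X / √m * Y) / √m) ≤
      4 * (l ^ 2 - 1) / √m * (l ^ 2 * W - (l ^ 2 - 1) * (X ^ 2 / m)) := by
    calc _ = 4 * (l ^ 2 - 1) / √m * (X / √m * Y) := by ring
      _ ≤ _ := by gcongr
  linarith

/-- Split the entry into the mean, of modulus `‖s‖ / m`, and a deviation `u`. Weighted
Cauchy–Schwarz bounds `(u + ‖s‖ / m)²` by `1 / m + 1 / l²` times `l² u² + ‖s‖² / m`, and `u²` is at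
most the variance. -/
theorem normSq_apply_le_energy (hβ : 0 < Fintype.card β) {l : ℝ} (hl : 1 ≤ l)
    (w : β → ℂ) (a₀ : β) :
    Complex.normSq (w a₀) ≤ (1 / Fintype.card β + 1 / l ^ 2) *
      (l ^ 2 * ∑ a, Complex.normSq (w a) -
        (l ^ 2 - 1) * (Complex.normSq (∑ a, w a) / Fintype.card β)) := by
  have hV := sum_normSq_add_mean hβ 1 (-1) w
  have hV0 := Finset.single_le_sum (f := fun a => Complex.normSq
      ((1 : ℝ) * w a + (-1 : ℝ) * ((Fintype.card β : ℂ)⁻¹ * ∑ c, w c)))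
      (fun _ _ => Complex.normSq_nonneg _) (Finset.mem_univ a₀)
  rw [hV] at hV0
  set W := ∑ a, Complex.normSq (w a)
  set s := ∑ a, w a
  have hm : (0 : ℝ) < Fintype.card β := by exact_mod_cast hβ
  have hn : ‖(Fintype.card β : ℂ)⁻¹ * s‖ = ‖s‖ / Fintype.card β := by
    rw [norm_mul, norm_inv, Complex.norm_natCast]; field_simp
  have htri := norm_add_le ((1 : ℝ) * w a₀ + (-1 : ℝ) * ((Fintype.card β : ℂ)⁻¹ * s))
    ((Fintype.card β : ℂ)⁻¹ * s)
  rw [hn] at htri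
  have he : ((1 : ℝ) * w a₀ + (-1 : ℝ) * ((Fintype.card β : ℂ)⁻¹ * s)) +
    ((Fintype.card β : ℂ)⁻¹ * s) = w a₀ := by push_cast; ring
  rw [he] at htri
  simp only [Complex.normSq_eq_norm_sq] at hV0 ⊢
  set m : ℝ := (Fintype.card β : ℝ)
  set u := ‖(1 : ℝ) * w a₀ + (-1 : ℝ) * ((Fintype.card β : ℂ)⁻¹ * s)‖
  have hu : u ^ 2 ≤ W - ‖s‖ ^ 2 / m := by linarith
  have hl2 : 0 < l ^ 2 := by positivity
  have h1 : ‖w a₀‖ ^ 2 ≤ (u + ‖s‖ / m) ^ 2 := by gcongr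
  have h2 : (u + ‖s‖ / m) ^ 2 ≤ (1 / m + 1 / l ^ 2) * (l ^ 2 * u ^ 2 + ‖s‖ ^ 2 / m) := by
    have : (1 / m + 1 / l ^ 2) * (l ^ 2 * u ^ 2 + ‖s‖ ^ 2 / m) - (u + ‖s‖ / m) ^ 2 =
        (l * u - ‖s‖ / l) ^ 2 / m := by
      have : l ≠ 0 := by positivity
      field_simp
      ring
    have h3 : 0 ≤ (l * u - ‖s‖ / l) ^ 2 / m := by positivity
    linarith
  refine h1.trans (h2.trans ?_)
  gcongr
  nlinarith

end Register

/-! ### The energy on a product of coordinates. -/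

section Tensor

variable {ι β : Type*} [Fintype ι] [DecidableEq ι] [Fintype β]

/-- The operator `P + l (1 - P)` on coordinate `i`, where `P` averages over this coordinate. -/
noncomputable def reweight (l : ℝ) (i : ι) : Module.End ℂ ((ι → β) → ℂ) where
  toFun v f := (l : ℂ) * v f +
    ((1 - l : ℝ) : ℂ) * ((Fintype.card β : ℂ)⁻¹ * ∑ a, v (Function.update f i a))
  map_add' v w := by
    ext f
    simp only [Pi.add_apply, Finset.sum_add_distrib]
    ring
  map_smul' c v := by
    ext f
    simp only [Pi.smul_apply, smul_eq_mul, ← Finset.mul_sum, RingHom.id_apply]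
    ring

theorem reweight_apply (l : ℝ) (i : ι) (v : (ι → β) → ℂ) (f : ι → β) :
    reweight l i v f = (l : ℂ) * v f +
      ((1 - l : ℝ) : ℂ) * ((Fintype.card β : ℂ)⁻¹ * ∑ a, v (Function.update f i a)) := rfl

theorem commute_reweight (l : ℝ) (i j : ι) :
    Commute (reweight (β := β) l i) (reweight l j) := by
  rcases eq_or_ne i j with rfl | hij
  · exact Commute.refl _
  ext1 v
  ext f
  simp only [Module.End.mul_apply, reweight_apply, Finset.sum_add_distrib, ← Finset.mul_sum]
  rw [Finset.sum_comm]
  simp_rw [Function.update_comm hij]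
  ring

/-- The product of the operators `reweight l i` over the coordinates in `T`. -/
noncomputable def reweightOn (l : ℝ) (T : Finset ι) : Module.End ℂ ((ι → β) → ℂ) :=
  T.noncommProd (reweight l) fun i _ j _ _ => commute_reweight l i j

theorem reweightOn_empty (l : ℝ) : reweightOn (β := β) l (∅ : Finset ι) = 1 :=
  Finset.noncommProd_empty _ _

theorem reweightOn_insert (l : ℝ) {T : Finset ι} {i : ι} (hi : i ∉ T) :
    reweightOn (β := β) l (insert i T) = reweight l i * reweightOn l T :=
  Finset.noncommProd_insert_of_notMem _ _ _ _ hi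

theorem reweightOn_insert' (l : ℝ) {T : Finset ι} {i : ι} (hi : i ∉ T) :
    reweightOn (β := β) l (insert i T) = reweightOn l T * reweight l i :=
  Finset.noncommProd_insert_of_notMem' _ _ _ _ hi

theorem reweightOn_const [Nonempty β] (l : ℝ) (T : Finset ι) (c : ℂ) :
    reweightOn l T (fun _ : ι → β => c) = fun _ => c := by
  induction T using Finset.induction_on with
  | empty => simp [reweightOn_empty]
  | insert i T hi ih =>
    rw [reweightOn_insert l hi, Module.End.mul_apply, ih]
    ext f
    rw [reweight_apply]
    simp
    ring

/-- Inequalities between sums over all functions can be checked on the lines in a coordinate. -/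
theorem sum_le_sum_of_update (i : ι) (g h : (ι → β) → ℝ)
    (H : ∀ f, ∑ a, g (Function.update f i a) ≤ ∑ a, h (Function.update f i a)) :
    ∑ f, g f ≤ ∑ f, h f := by
  classical
  rcases isEmpty_or_nonempty β with hβ | ⟨⟨b⟩⟩
  · have : IsEmpty (ι → β) := ⟨fun f => hβ.elim (f i)⟩
    simp
  have key : ∀ g : (ι → β) → ℝ, ∑ f, g f =
      ∑ r : {j // j ≠ i} → β, ∑ a, g ((Equiv.funSplitAt i β).symm (a, r)) := by
    intro g
    rw [Finset.sum_comm, ← Fintype.sum_prod_type']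
    exact (Equiv.sum_comp (Equiv.funSplitAt i β).symm g).symm
  rw [key g, key h]
  refine Finset.sum_le_sum fun r _ => ?_
  have e : ∀ a, (Equiv.funSplitAt i β).symm (a, r) =
      Function.update ((Equiv.funSplitAt i β).symm (b, r)) i a := by
    intro a
    ext j
    rcases eq_or_ne j i with rfl | hj
    · simp
    · simp [hj]
  rw [Finset.sum_congr rfl fun a _ => congrArg g (e a),
    Finset.sum_congr rfl fun a _ => congrArg h (e a)]
  exact H _

theorem sum_normSq_reweight_update [Nonempty β] (l : ℝ) (i : ι) (v : (ι → β) → ℂ) (f : ι → β) :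
    ∑ a, Complex.normSq (reweight l i v (Function.update f i a)) =
      l ^ 2 * ∑ a, Complex.normSq (v (Function.update f i a)) -
        (l ^ 2 - 1) * (Complex.normSq (∑ a, v (Function.update f i a)) / Fintype.card β) := by
  simp only [reweight_apply, Function.update_idem]
  rw [sum_normSq_add_mean Fintype.card_pos l (1 - l) fun a => v (Function.update f i a)]
  ring

/-- The energy of a function on `ι → β`, in which every coordinate that deviates from uniform
counts with weight `l ^ 2`. -/
noncomputable def energy (l : ℝ) (v : (ι → β) → ℂ) : ℝ :=
  ∑ f, Complex.normSq (reweightOn l Finset.univ v f)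

theorem energy_const [Nonempty β] (l : ℝ) (c : ℂ) :
    energy l (fun _ : ι → β => c) =
      (Fintype.card β : ℝ) ^ Fintype.card ι * Complex.normSq c := by
  classical
  simp [energy, reweightOn_const]

theorem energy_nonneg (l : ℝ) (v : (ι → β) → ℂ) : 0 ≤ energy l v :=
  Finset.sum_nonneg fun _ _ => Complex.normSq_nonneg _

theorem energy_smul (l : ℝ) (c : ℂ) (v : (ι → β) → ℂ) :
    energy l (c • v) = Complex.normSq c * energy l v := by
  simp [energy, Finset.mul_sum]

/-- The one-coordinate bound `normSq_apply_le_energy` tensorizes: coordinates are peeled off one at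
a time, with the induction hypothesis applied to the already reweighted function. -/
theorem sum_normSq_agree_le [DecidableEq β] {l : ℝ} (hl : 1 ≤ l) (g : ι → β) (T : Finset ι)
    (v : (ι → β) → ℂ) :
    ∑ f, (if ∀ i ∈ T, f i = g i then Complex.normSq (v f) else 0) ≤
      (1 / Fintype.card β + 1 / l ^ 2 : ℝ) ^ T.card *
        ∑ f, Complex.normSq (reweightOn l T v f) := by
  induction T using Finset.induction_on generalizing v with
  | empty => simp [reweightOn_empty]
  | insert i T hi ih =>
    have : Nonempty β := ⟨g i⟩
    rw [Finset.card_insert_of_notMem hi, pow_succ', mul_assoc, reweightOn_insert' l hi]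
    refine le_trans ?_ (mul_le_mul_of_nonneg_left (ih (reweight l i v)) (by positivity))
    rw [Finset.mul_sum]
    refine sum_le_sum_of_update i _ _ fun f => ?_
    have hT : ∀ a, (∀ j ∈ T, Function.update f i a j = g j) ↔ ∀ j ∈ T, f j = g j := by
      intro a
      refine forall₂_congr fun j hj => ?_
      rw [Function.update_of_ne (ne_of_mem_of_not_mem hj hi)]
    simp only [Finset.forall_mem_insert, hT, Function.update_self]
    by_cases h : ∀ j ∈ T, f j = g j
    · have e : ∀ a, (a = g i ∧ ∀ j ∈ T, f j = g j) ↔ a = g i := fun a => and_iff_left h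
      simp only [e, if_pos h]
      rw [← Finset.mul_sum, sum_normSq_reweight_update, Finset.sum_eq_single (g i)
        (fun a _ ha => if_neg ha) (fun h => absurd (Finset.mem_univ _) h), if_pos rfl]
      exact normSq_apply_le_energy Fintype.card_pos hl
        (fun a => v (Function.update f i a)) (g i)
    · simp [h]

theorem normSq_apply_le {l : ℝ} (hl : 1 ≤ l) (g : ι → β) (v : (ι → β) → ℂ) :
    Complex.normSq (v g) ≤
      (1 / Fintype.card β + 1 / l ^ 2 : ℝ) ^ Fintype.card ι * energy l v := by
  classical
  have h := sum_normSq_agree_le hl g Finset.univ v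
  simp only [Finset.mem_univ, forall_const, ← funext_iff] at h
  rwa [Finset.sum_ite_eq' Finset.univ g, if_pos (Finset.mem_univ _), Finset.card_univ] at h

/-- The energy grows little when a phase is applied at one value of one coordinate. -/
theorem energy_phase_mul_le [DecidableEq β] {l : ℝ} (hl : 1 ≤ l) (i : ι) (a₀ : β) {z : ℂ}
    (hz : ‖z‖ = 1) (v : (ι → β) → ℂ) :
    energy l (fun f => (if f i = a₀ then z else 1) * v f) ≤
      (1 + 4 * (l ^ 2 - 1) / √(Fintype.card β)) * energy l v := by
  have : Nonempty β := ⟨a₀⟩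
  -- The phase depends on coordinate `i` only, so it commutes with reweighting the others. What
  -- remains is `energy_phase_le` on each line in direction `i`.
  have hcomm : ∀ T : Finset ι, i ∉ T → ∀ v : (ι → β) → ℂ,
      reweightOn l T (fun f => (if f i = a₀ then z else 1) * v f) =
        fun f => (if f i = a₀ then z else 1) * reweightOn l T v f := by
    intro T
    induction T using Finset.induction_on with
    | empty => intro _ v; simp [reweightOn_empty]
    | insert j T hj ih =>
      intro hi v
      rw [Finset.mem_insert, not_or] at hi
      rw [reweightOn_insert l hj, Module.End.mul_apply, ih hi.2, Module.End.mul_apply]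
      ext f
      simp only [reweight_apply, Function.update_of_ne hi.1]
      rw [← Finset.mul_sum]
      ring
  have hu : (Finset.univ : Finset ι) = insert i (Finset.univ.erase i) := by simp
  unfold energy
  rw [hu, reweightOn_insert l (Finset.notMem_erase i _), Module.End.mul_apply,
    hcomm _ (Finset.notMem_erase i _), Finset.mul_sum]
  refine sum_le_sum_of_update i _ _ fun f => ?_
  rw [← Finset.mul_sum, Module.End.mul_apply, sum_normSq_reweight_update,
    sum_normSq_reweight_update]
  simp only [Function.update_self]
  exact energy_phase_le Fintype.card_pos hl
    (fun a => reweightOn l (Finset.univ.erase i) v (Function.update f i a)) a₀ hz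

end Tensor

end QSort

/-! ### The energy along a run, and success bounds for slices. -/

namespace QSort

open Matrix
open scoped ComplexOrder

set_option linter.unusedSectionVars false

variable {N S : ℕ} {ι β : Type*} [Fintype ι] [DecidableEq ι] [Fintype β] [DecidableEq β]

theorem sum_normSq_kraus {k : Type*} [Fintype k] (K : k → Op S) (hK : ∑ j, (K j)ᴴ * K j = 1)
    (φ : Basis S → ℂ) :
    ∑ j, ∑ b, Complex.normSq ((K j *ᵥ φ) b) = ∑ b, Complex.normSq (φ b) := by
  have key : ∀ ψ : Basis S → ℂ,
      ∑ b, Complex.normSq (ψ b) = (vecMulVec ψ (star ψ)).trace.re := by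
    intro ψ
    rw [trace_vecMulVec, dotProduct, Complex.re_sum]
    refine Finset.sum_congr rfl fun b _ => ?_
    rw [Pi.star_apply, Complex.star_def, Complex.mul_conj, Complex.ofReal_re]
  simp_rw [key, ← conj_vecMulVec]
  rw [← Complex.re_sum, ← Matrix.trace_sum, trace_sum_kraus K hK]

/-- Reweighting acts on the index and the Kraus operators on the memory, so they commute; for each
index the Kraus branches preserve the total squared norm. -/
theorem sum_energy_kraus {k : Type*} [Fintype k] (l : ℝ) (K : k → Op S)
    (hK : ∑ j, (K j)ᴴ * K j = 1) (ψ : (ι → β) → Basis S → ℂ) :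
    ∑ j, ∑ b, energy l (fun g => (K j *ᵥ ψ g) b) = ∑ b, energy l (fun g => ψ g b) := by
  have e : ∀ j b g, reweightOn l Finset.univ (fun g => (K j *ᵥ ψ g) b) g =
      (K j *ᵥ fun b' => reweightOn l Finset.univ (fun g => ψ g b') g) b := by
    intro j b g
    have : (fun g => (K j *ᵥ ψ g) b) = ∑ b', K j b b' • fun g => ψ g b' := by
      ext g
      simp [mulVec, dotProduct, Finset.sum_apply]
    rw [this, map_sum, Finset.sum_apply]
    simp [mulVec, dotProduct]
  unfold energy
  simp_rw [e]
  rw [Finset.sum_comm (s := (Finset.univ : Finset (Basis S))),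
    Finset.sum_congr rfl fun j _ => Finset.sum_comm (s := (Finset.univ : Finset (Basis S))),
    Finset.sum_comm (s := (Finset.univ : Finset k))]
  exact Finset.sum_congr rfl fun g _ => sum_normSq_kraus K hK _

/-- The inputs of the family `F` differ at each point in one coordinate of the index at most. -/
def IsLocalFamily (F : (ι → β) → Fin N → Fin 3) : Prop :=
  ∀ x p, (∃ z : ℂ, ‖z‖ = 1 ∧ ∀ g, phase (F g) x p = z) ∨
    ∃ i a z, ‖z‖ = 1 ∧ ∀ g, phase (F g) x p = if g i = a then z else 1

theorem energy_phase_family_le {F : (ι → β) → Fin N → Fin 3} (hF : IsLocalFamily F) {l : ℝ}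
    (hl : 1 ≤ l) (x p : ℕ) (v : (ι → β) → ℂ) :
    energy l (fun g => phase (F g) x p * v g) ≤
      (1 + 4 * (l ^ 2 - 1) / √(Fintype.card β)) * energy l v := by
  rcases hF x p with ⟨z, hz, h⟩ | ⟨i, a, z, hz, h⟩
  · simp_rw [h]
    have := energy_smul l z v
    rw [Complex.normSq_eq_norm_sq, hz, one_pow, one_mul] at this
    refine (le_of_eq this).trans (le_mul_of_one_le_left (energy_nonneg l v) ?_)
    have : 0 ≤ l ^ 2 - 1 := by nlinarith
    have : 0 ≤ 4 * (l ^ 2 - 1) / √(Fintype.card β : ℝ) := by positivity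
    linarith
  · simp_rw [h]
    exact energy_phase_mul_le hl i a hz v

theorem sum_energy_oracle_le {F : (ι → β) → Fin N → Fin 3} (hF : IsLocalFamily F) {l : ℝ}
    (hl : 1 ≤ l) (reg : Fin (width N) ⊕ Fin 2 ↪ Fin S) (ψ : (ι → β) → Basis S → ℂ) :
    ∑ b, energy l (fun g => (oracleOp (F g) reg *ᵥ ψ g) b) ≤
      (1 + 4 * (l ^ 2 - 1) / √(Fintype.card β)) * ∑ b, energy l (fun g => ψ g b) := by
  rw [Finset.mul_sum]
  refine Finset.sum_le_sum fun b _ => ?_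
  simp only [oracleOp, mulVec_diagonal]
  exact energy_phase_family_le hF hl _ _ _

/-- A circuit with few queries rarely finds the index of a random input of a local family. -/
theorem sum_expect_pure_le {F : (ι → β) → Fin N → Fin 3} (hF : IsLocalFamily F) {l : ℝ}
    (hl : 1 ≤ l) (gs : List (Gate N S)) (good : (ι → β) → List Bool → Prop)
    (hgood : ∀ o g g', good g o → good g' o → g = g') (ψ : (ι → β) → Basis S → ℂ) :
    ∑ g, expect (F g) gs (indic (good g)) (vecMulVec (ψ g) (star (ψ g))) ≤
      (1 / Fintype.card β + 1 / l ^ 2 : ℝ) ^ Fintype.card ι *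
        (1 + 4 * (l ^ 2 - 1) / √(Fintype.card β)) ^ gs.countP Gate.isOracle *
        ∑ b, energy l (fun g => ψ g b) := by
  have hl2 : 0 ≤ l ^ 2 - 1 := by nlinarith
  induction gs generalizing good ψ with
  | nil =>
    simp only [List.countP_nil, pow_zero, mul_one, expect]
    have htr : ∀ g, (vecMulVec (ψ g) (star (ψ g))).trace.re = ∑ b, Complex.normSq (ψ g b) := by
      intro g
      rw [trace_vecMulVec, dotProduct, Complex.re_sum]
      refine Finset.sum_congr rfl fun b _ => ?_
      rw [Pi.star_apply, Complex.star_def, Complex.mul_conj, Complex.ofReal_re]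
    -- By `hgood` at most one index accepts a given output, so only the weight at one point counts.
    by_cases h : ∃ g, good g []
    · obtain ⟨g, hg⟩ := h
      rw [Finset.sum_eq_single g, htr, indic, if_pos hg, one_mul, Finset.mul_sum]
      · exact Finset.sum_le_sum fun b _ => normSq_apply_le hl g fun g => ψ g b
      · intro g' _ hne
        rw [indic, if_neg fun h => hne (hgood _ _ _ h hg), zero_mul]
      · exact fun h => absurd (Finset.mem_univ _) h
    · rw [Finset.sum_eq_zero fun g _ => by
        rw [indic, if_neg (not_exists.1 h g), zero_mul]]
      exact mul_nonneg (by positivity) (Finset.sum_nonneg fun _ _ => energy_nonneg _ _)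
  | cons c gs ih =>
    cases c with
    | oracle reg =>
      simp only [expect, conj_vecMulVec]
      refine (ih good hgood _).trans ?_
      rw [List.countP_cons_of_pos (by rfl), pow_succ (1 + _), ← mul_assoc, mul_assoc _ (1 + _)]
      exact mul_le_mul_of_nonneg_left (sum_energy_oracle_le hF hl reg ψ) (by positivity)
    | channel k K hK =>
      -- Each Kraus branch keeps the states pure, so the induction applies per branch and the
      -- energies add up.
      simp only [expect, conj_vecMulVec, expect_sum]
      rw [Finset.sum_comm, List.countP_cons_of_neg (by simp [Gate.isOracle]),
        ← sum_energy_kraus l K hK ψ, Finset.mul_sum]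
      exact Finset.sum_le_sum fun j _ => ih good hgood _
    | output K hK =>
      simp only [expect, conj_vecMulVec]
      rw [Finset.sum_comm, List.countP_cons_of_neg (by simp [Gate.isOracle]),
        ← sum_energy_kraus l K hK ψ, Finset.mul_sum]
      exact Finset.sum_le_sum fun b _ => ih (fun g o => good g (b :: o))
        (fun o => hgood (b :: o)) _

/-- A start state that does not depend on the index has no deviation from uniform, so its energy is
just the number of indices. -/
theorem sum_expect_basis_le [Nonempty β] {F : (ι → β) → Fin N → Fin 3} (hF : IsLocalFamily F)
    {l : ℝ} (hl : 1 ≤ l) (gs : List (Gate N S)) (good : (ι → β) → List Bool → Prop)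
    (hgood : ∀ o g g', good g o → good g' o → g = g') (b : Basis S) :
    ∑ g, expect (F g) gs (indic (good g)) (Matrix.single b b 1) ≤
      (1 / Fintype.card β + 1 / l ^ 2 : ℝ) ^ Fintype.card ι *
        (1 + 4 * (l ^ 2 - 1) / √(Fintype.card β)) ^ gs.countP Gate.isOracle *
        (Fintype.card β : ℝ) ^ Fintype.card ι := by
  simp_rw [single_eq_vecMulVec]
  refine (sum_expect_pure_le hF hl gs good hgood fun _ => Pi.single b 1).trans (le_of_eq ?_)
  congr 1
  simp_rw [energy_const, ← Finset.mul_sum]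
  rw [Finset.sum_eq_single b] <;> simp +contextual

theorem indic_nonneg (p : List Bool → Prop) (o : List Bool) : 0 ≤ indic p o := by
  unfold indic; split_ifs <;> norm_num

theorem indic_le_indic {p q : List Bool → Prop} {o o' : List Bool} (h : p o → q o') :
    indic p o ≤ indic q o' := by
  unfold indic
  split_ifs with h1 h2 h2
  · exact le_rfl
  · exact absurd (h h1) h2
  · exact zero_le_one
  · exact le_rfl

theorem le_of_forall_successProb [Nonempty β] {F : (ι → β) → Fin N → Fin 3} {C : Circuit N S}
    {M : ℝ} (hC : ∀ f, 2 / 3 ≤ C.successProb f)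
    (hM : ∑ g, C.successProb (F g) ≤ M * (Fintype.card β : ℝ) ^ Fintype.card ι) : 2 / 3 ≤ M := by
  have h1 : ∑ _g : ι → β, (2 / 3 : ℝ) ≤ ∑ g, C.successProb (F g) :=
    Finset.sum_le_sum fun g _ => hC _
  rw [Finset.sum_const, Finset.card_univ, Fintype.card_fun, nsmul_eq_mul] at h1
  have hpos : (0 : ℝ) < (Fintype.card β : ℝ) ^ Fintype.card ι := by
    have : 0 < Fintype.card β := Fintype.card_pos
    positivity
  push_cast at h1
  nlinarith

/-- The bound for a slice of a circuit that outputs the index of the input. -/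
theorem slice_bound [Nonempty β] {F : (ι → β) → Fin N → Fin 3} (hF : IsLocalFamily F) {l : ℝ}
    (hl : 1 ≤ l) (good : (ι → β) → List Bool → Prop)
    (hgood : ∀ o g g', good g o → good g' o → g = g') {C : Circuit N S}
    (hC : ∀ f, 2 / 3 ≤ C.successProb f) (g₁ g₂ g₃ : List (Gate N S))
    (hgates : C.gates = g₁ ++ (g₂ ++ g₃))
    (hsort : ∀ g o₁ o₂ o₃, o₁.length = g₁.countP Gate.isOutput →
      o₂.length = g₂.countP Gate.isOutput → IsSorting (F g) (o₁ ++ (o₂ ++ o₃)) → good g o₂) :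
    2 / 3 ≤ 2 ^ S * ((1 / Fintype.card β + 1 / l ^ 2 : ℝ) ^ Fintype.card ι *
        (1 + 4 * (l ^ 2 - 1) / √(Fintype.card β)) ^ g₂.countP Gate.isOracle) := by
  refine le_of_forall_successProb (F := F) hC ?_
  set ρ : Op S := Matrix.single (fun _ => false) (fun _ => false) 1
  have hρ : ρ.PosSemidef := posSemidef_single _
  have step : ∀ g, C.successProb (F g) ≤
      ∑ b : Basis S, expect (F g) g₂ (indic (good g)) (Matrix.single b b 1) := by
    intro g
    rw [successProb_eq_expect, hgates]
    have hρ' := posSemidef_evolve (F g) g₁ hρ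
    -- The earlier bits are quantified away: some string of the right length completes the output.
    refine (expect_append_le_evolve (F g) g₁ (g₂ ++ g₃)
      (χ' := indic fun o => ∃ o₁ : List Bool, o₁.length = g₁.countP Gate.isOutput ∧
        IsSorting (F g) (o₁ ++ o))
      (fun o₁ o₂ h₁ => indic_le_indic fun h => ⟨o₁, h₁, h⟩) hρ).trans ?_
    refine (expect_append_le (F g) g₂ g₃ (χ' := indic (good g))
      (fun o₂ o₃ h₂ => indic_le_indic ?_) hρ').trans ?_
    · rintro ⟨o₁, h₁, h⟩
      exact hsort g o₁ o₂ o₃ h₁ h₂ h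
    · refine expect_le_sum_basis (F g) g₂ (indic_nonneg _) hρ' ?_
      rw [trace_evolve]
      simp [ρ]
  refine (Finset.sum_le_sum fun g _ => step g).trans ?_
  rw [Finset.sum_comm]
  refine (Finset.sum_le_sum fun b _ => sum_expect_basis_le hF hl g₂ good hgood b).trans
    (le_of_eq ?_)
  simp only [Finset.sum_const, Finset.card_univ, Fintype.card_fun, Fintype.card_bool,
    Fintype.card_fin, nsmul_eq_mul]
  push_cast
  ring

/-- The bound for the first slice of a circuit, in which the space does not occur. -/
theorem first_slice_bound [Nonempty β] {F : (ι → β) → Fin N → Fin 3} (hF : IsLocalFamily F)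
    {l : ℝ} (hl : 1 ≤ l) (good : (ι → β) → List Bool → Prop)
    (hgood : ∀ o g g', good g o → good g' o → g = g') {C : Circuit N S}
    (hC : ∀ f, 2 / 3 ≤ C.successProb f) (g₂ g₃ : List (Gate N S)) (hgates : C.gates = g₂ ++ g₃)
    (hsort : ∀ g o₂ o₃, o₂.length = g₂.countP Gate.isOutput →
      IsSorting (F g) (o₂ ++ o₃) → good g o₂) :
    2 / 3 ≤ (1 / Fintype.card β + 1 / l ^ 2 : ℝ) ^ Fintype.card ι *
        (1 + 4 * (l ^ 2 - 1) / √(Fintype.card β)) ^ g₂.countP Gate.isOracle := by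
  refine le_of_forall_successProb (F := F) hC ?_
  refine (Finset.sum_le_sum fun g _ => ?_).trans
    (sum_expect_basis_le hF hl g₂ good hgood fun _ => false)
  rw [successProb_eq_expect, hgates]
  exact expect_append_le (F g) g₂ g₃
    (fun o₂ o₃ h₂ => indic_le_indic (hsort g o₂ o₃ h₂)) (posSemidef_single _)

end QSort

/-! ### The hard inputs, and what a block of output reveals about them. -/

namespace QSort

/-- The input that is `2` on the first `a` points, and among the next `K * m` points, in groups
of size `m`, is `1` at the point with offset `g i` in the `i`-th group; it is `0` elsewhere. -/
noncomputable def hardInput (N a : ℕ) {K m : ℕ} (g : Fin K → Fin m) : Fin N → Fin 3 :=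
  open Classical in
  fun x => if (x : ℕ) < a then 2 else if ∃ i : Fin K, (x : ℕ) = a + i * m + g i then 1 else 0

variable {N a K m : ℕ}

theorem offset_inj {i i' c c' : ℕ} (hc : c < m) (hc' : c' < m)
    (h : a + i * m + c = a + i' * m + c') : i = i' ∧ c = c' := by
  have h1 : c + m * i = c' + m * i' := by rw [mul_comm m, mul_comm m]; omega
  have hm : 0 < m := by omega
  constructor
  · have := congrArg (· / m) h1
    simpa [Nat.add_mul_div_left _ _ hm, Nat.div_eq_of_lt hc, Nat.div_eq_of_lt hc'] using this
  · have := congrArg (· % m) h1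
    simpa [Nat.mod_eq_of_lt hc, Nat.mod_eq_of_lt hc'] using this

theorem phase_congr {f f' : Fin N → Fin 3} {x : ℕ} (p : ℕ)
    (h : ∀ hx : x < N, f ⟨x, hx⟩ = f' ⟨x, hx⟩) : phase f x p = phase f' x p := by
  unfold phase
  split_ifs with hx
  · rw [h hx]
  · rfl

/-- A point inside a group has value `1` exactly when that group's offset points at it, and
otherwise value `0`, which carries phase `1`. Elsewhere the value is fixed. -/
theorem isLocalFamily_hardInput : IsLocalFamily (hardInput N a (K := K) (m := m)) := by
  intro x p
  have hconst : ∀ v : Fin 3, (∀ (g : Fin K → Fin m) (hx : x < N), hardInput N a g ⟨x, hx⟩ = v) →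
      ∃ z : ℂ, ‖z‖ = 1 ∧ ∀ g : Fin K → Fin m, phase (hardInput N a g) x p = z := fun v hv =>
    ⟨phase (fun _ : Fin N => v) x p, norm_phase _ _ _, fun g => phase_congr p (hv g)⟩
  by_cases h1 : x < a
  · exact Or.inl (hconst 2 fun g hx => by simp [hardInput, h1])
  by_cases h2 : x < a + K * m
  · right
    have hm : 0 < m := Nat.pos_of_ne_zero fun h => by simp [h] at h2; omega
    have hi : (x - a) / m < K := by rw [Nat.div_lt_iff_lt_mul hm]; omega
    have hdm : x = a + (x - a) / m * m + (x - a) % m := by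
      have := Nat.div_add_mod' (x - a) m; omega
    refine ⟨⟨_, hi⟩, ⟨_, Nat.mod_lt (x - a) hm⟩, phase (fun _ : Fin N => 1) x p,
      norm_phase _ _ _, fun g => ?_⟩
    have hone : phase (fun _ : Fin N => 0) x p = 1 := by simp [phase]
    have hiff : (∃ i : Fin K, x = a + i * m + g i) ↔
        g ⟨_, hi⟩ = ⟨_, Nat.mod_lt (x - a) hm⟩ := by
      constructor
      · rintro ⟨i, h⟩
        obtain ⟨e1, e2⟩ := offset_inj (g i).2 (Nat.mod_lt (x - a) hm) (h.symm.trans hdm)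
        have : i = ⟨_, hi⟩ := Fin.ext e1
        subst this
        exact Fin.ext e2
      · intro h
        exact ⟨⟨_, hi⟩, by rw [h]; exact hdm⟩
    split_ifs with h
    · exact phase_congr p fun hx => by simp [hardInput, h1, hiff.2 h]
    · rw [← hone]
      refine phase_congr p fun hx => ?_
      simp only [hardInput, h1, if_false, if_neg (mt hiff.1 h)]
  · refine Or.inl (hconst 0 fun g hx => ?_)
    have : ¬ ∃ i : Fin K, x = a + i * m + g i := by
      rintro ⟨i, h⟩
      have h3 : ((i : ℕ) + 1) * m ≤ K * m := Nat.mul_le_mul_right m i.2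
      have := (g i).2
      rw [add_mul, one_mul] at h3
      omega
    simp only [hardInput, h1, if_false, if_neg this]

theorem hardInput_eq_two_iff (g : Fin K → Fin m) (y : Fin N) :
    hardInput N a g y = 2 ↔ (y : ℕ) < a := by
  unfold hardInput
  split_ifs <;> simp_all

theorem hardInput_eq_one_iff (g : Fin K → Fin m) (y : Fin N) :
    hardInput N a g y = 1 ↔ ∃ i : Fin K, (y : ℕ) = a + i * m + g i := by
  unfold hardInput
  split_ifs with h1 h2
  · refine iff_of_false (by decide) ?_
    rintro ⟨i, hi⟩
    omega
  · exact iff_of_true rfl h2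
  · exact iff_of_false (by decide) h2

theorem group_lt (ha : a + K * m ≤ N) (g : Fin K → Fin m) (i : Fin K) :
    a + i * m + g i < N := by
  have h3 : ((i : ℕ) + 1) * m ≤ K * m := Nat.mul_le_mul_right m i.2
  have := (g i).2
  rw [add_mul, one_mul] at h3
  omega

/-- The elements of rank `a, …, a + K - 1` of a sorting of a hard input have the value `1`. -/
theorem hardInput_apply_rank (ha : a + K * m ≤ N) (g : Fin K → Fin m) {x : Fin N → Fin N}
    (hx : Function.Injective x) (hanti : Antitone (hardInput N a g ∘ x)) {r : Fin N}
    (h1 : a ≤ r) (h2 : (r : ℕ) < a + K) : hardInput N a g (x r) = 1 := by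
  -- Otherwise the `r + 1 > a` elements of rank up to `r` would all be among the `a` points of value
  -- `2`.
  have hne2 : hardInput N a g (x r) ≠ 2 := by
    intro h
    have hsub : ∀ s ∈ Finset.Iic r, ((x s : Fin N) : ℕ) ∈ Finset.range a := by
      intro s hs
      have h3 := hanti (Finset.mem_Iic.1 hs)
      simp only [Function.comp_apply, h] at h3
      rw [Finset.mem_range, ← hardInput_eq_two_iff g]
      exact le_antisymm (Fin.le_last _) h3
    have := Finset.card_le_card_of_injOn _ hsub
      (fun s _ t _ hst => hx (Fin.ext hst))
    rw [Fin.card_Iic, Finset.card_range] at this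
    omega
  -- Otherwise the `a + K` points of nonzero value would all have rank below `r < a + K`.
  have hne0 : hardInput N a g (x r) ≠ 0 := by
    intro h
    have hsurj := Finite.surjective_of_injective hx
    have hlt : ∀ s, hardInput N a g (x s) ≠ 0 → s < r := by
      intro s hs
      by_contra hc
      have h3 := hanti (not_lt.1 hc)
      simp only [Function.comp_apply, h] at h3
      exact hs (le_antisymm h3 (Fin.zero_le _))
    have hKm : a ≤ N := by omega
    let e : Fin a ⊕ Fin K → Fin N :=
      Sum.elim (fun t => ⟨t, by omega⟩) fun i => ⟨a + i * m + g i, group_lt ha g i⟩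
    have he : Function.Injective e := by
      rintro (s | i) (t | i') h
      · simpa [e, Fin.ext_iff] using h
      · simp only [e, Sum.elim_inl, Sum.elim_inr, Fin.mk.injEq] at h
        omega
      · simp only [e, Sum.elim_inl, Sum.elim_inr, Fin.mk.injEq] at h
        omega
      · simp only [e, Sum.elim_inr, Fin.mk.injEq] at h
        exact congrArg _ (Fin.ext (offset_inj (g i).2 (g i').2 h).1)
    have hv : ∀ u, hardInput N a g (e u) ≠ 0 := by
      rintro (s | i)
      · have := (hardInput_eq_two_iff g (e (Sum.inl s))).2 s.2
        rw [this]; decide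
      · have := (hardInput_eq_one_iff g (e (Sum.inr i))).2 ⟨i, rfl⟩
        rw [this]; decide
    choose y hy using hsurj
    have := Finset.card_le_card_of_injOn (s := (Finset.univ : Finset (Fin a ⊕ Fin K)))
      (t := Finset.Iio r) (fun u => y (e u))
      (fun u _ => Finset.mem_coe.2 (Finset.mem_Iio.2 (hlt _ (by rw [hy]; exact hv u))))
      (fun u _ v _ huv => he (by rw [← hy (e u), ← hy (e v)]; exact congrArg x huv))
    rw [Fin.card_Iio, Finset.card_univ, Fintype.card_sum, Fintype.card_fin,
      Fintype.card_fin] at this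
    omega
  revert hne0 hne2
  generalize hardInput N a g (x r) = v
  revert v
  decide

theorem getElem?_encode (x : Fin N → Fin N) (r : Fin N) {t : ℕ} (ht : t < width N) :
    (encode x)[r * width N + t]? = some (Nat.testBit (x r) t) := by
  have hlt : (r : ℕ) * width N + t < N * width N := by
    have h3 : ((r : ℕ) + 1) * width N ≤ N * width N := Nat.mul_le_mul_right _ r.2
    rw [add_mul, one_mul] at h3
    omega
  have hw : 0 < width N := by omega
  have e : encode x = List.ofFn fun q : Fin (N * width N) =>
      Nat.testBit (x ⟨q / width N, by rw [Nat.div_lt_iff_lt_mul hw]; exact q.2⟩)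
        (q % width N) := by
    rw [List.ofFn_mul, encode]
    congr 2
    ext1 i
    congr 1
    ext1 j
    have h1 : ((i : ℕ) * width N + j) / width N = i := by
      rw [mul_comm, Nat.mul_add_div hw, Nat.div_eq_of_lt j.2, add_zero]
    have h2 : ((i : ℕ) * width N + j) % width N = j := by
      rw [mul_comm, Nat.mul_add_mod, Nat.mod_eq_of_lt j.2]
    simp only [h1, h2]
  have h1 : ((r : ℕ) * width N + t) / width N = r := by
    rw [mul_comm, Nat.mul_add_div hw, Nat.div_eq_of_lt ht, add_zero]
  have h2 : ((r : ℕ) * width N + t) % width N = t := by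
    rw [mul_comm, Nat.mul_add_mod, Nat.mod_eq_of_lt ht]
  rw [e, List.getElem?_ofFn, dif_pos hlt]
  simp only [h1, h2]

theorem length_encode (x : Fin N → Fin N) : (encode x).length = N * width N := by
  simp [encode, List.length_flatten, Function.comp_def]

/-- The bits `o` are those of the elements of rank `a, …, a + K - 1` in a sorting of `f`. -/
def IsSortingBlock (a K : ℕ) (f : Fin N → Fin 3) (o : List Bool) : Prop :=
  ∃ x : Fin N → Fin N, Function.Injective x ∧ Antitone (f ∘ x) ∧
    ∀ r : Fin N, a ≤ r → (r : ℕ) < a + K → ∀ t < width N,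
      o[(r - a) * width N + t]? = some (Nat.testBit (x r) t)

/-- Every term takes exactly `width N` bits, so the number of bits written earlier determines which
ranks a slice writes. -/
theorem IsSorting.block {f : Fin N → Fin 3} {o₁ o₂ o₃ : List Bool}
    (h₁ : o₁.length = a * width N) (h₂ : o₂.length = K * width N)
    (h : IsSorting f (o₁ ++ (o₂ ++ o₃))) : IsSortingBlock a K f o₂ := by
  obtain ⟨x, hx, hanti, ho⟩ := h
  refine ⟨x, hx, hanti, fun r h1 h2 t ht => ?_⟩
  rw [← getElem?_encode x r ht, ← ho]
  have e : (r : ℕ) * width N + t = o₁.length + ((r - a) * width N + t) := by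
    rw [h₁, ← add_assoc, ← add_mul]
    congr 2
    omega
  have hlt : (r - a) * width N + t < o₂.length := by
    have h3 : ((r : ℕ) - a + 1) * width N ≤ K * width N := Nat.mul_le_mul_right _ (by omega)
    rw [add_mul, one_mul] at h3
    omega
  rw [e, List.getElem?_append_right (by omega), Nat.add_sub_cancel_left,
    List.getElem?_append_left hlt]

theorem IsSortingBlock.index_unique (ha : a + K * m ≤ N) (o : List Bool) (g g' : Fin K → Fin m)
    (h : IsSortingBlock a K (hardInput N a g) o) (h' : IsSortingBlock a K (hardInput N a g') o) :
    g = g' := by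
  obtain ⟨x, hx, hanti, hb⟩ := h
  obtain ⟨x', hx', hanti', hb'⟩ := h'
  have hpow : N ≤ 2 ^ width N := Nat.le_pow_clog (by norm_num) N
  have hxx : ∀ r : Fin N, a ≤ r → (r : ℕ) < a + K → x r = x' r := by
    intro r h1 h2
    refine Fin.ext (Nat.eq_of_testBit_eq fun t => ?_)
    rcases lt_or_ge t (width N) with ht | ht
    · have := (hb r h1 h2 t ht).symm.trans (hb' r h1 h2 t ht)
      simpa using this
    · rw [Nat.testBit_lt_two_pow, Nat.testBit_lt_two_pow]
      · exact (x' r).2.trans_le (hpow.trans (Nat.pow_le_pow_right (by norm_num) ht))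
      · exact (x r).2.trans_le (hpow.trans (Nat.pow_le_pow_right (by norm_num) ht))
  have hlt : ∀ s : Fin K, a + (s : ℕ) < N := by
    intro s
    have hm : 0 < m := (Nat.zero_le _).trans_lt (g s).2
    have := Nat.le_mul_of_pos_right K hm
    omega
  have hone : ∀ s : Fin K, ∃ i : Fin K, (x ⟨a + s, hlt s⟩ : ℕ) = a + i * m + g i := fun s =>
    (hardInput_eq_one_iff g _).1 (hardInput_apply_rank ha g hx hanti
      (r := ⟨a + s, hlt s⟩) (Nat.le_add_right _ _) (by simp))
  have hone' : ∀ s : Fin K, ∃ i : Fin K, (x ⟨a + s, hlt s⟩ : ℕ) = a + i * m + g' i := fun s => by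
    rw [hxx _ (Nat.le_add_right _ _) (by simp)]
    exact (hardInput_eq_one_iff g' _).1 (hardInput_apply_rank ha g' hx' hanti'
      (r := ⟨a + s, hlt s⟩) (Nat.le_add_right _ _) (by simp))
  choose i hi using hone
  -- Each group holds only one marked point, so distinct ranks lie in distinct groups; `K` ranks
  -- therefore reach all `K` groups and reveal every offset.
  have hinj : Function.Injective i := by
    intro s t hst
    have : x ⟨a + s, hlt s⟩ = x ⟨a + t, hlt t⟩ := Fin.ext (by rw [hi, hi, hst])
    have := congrArg Fin.val (hx this)
    exact Fin.ext (by simpa using this)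
  ext k
  obtain ⟨s, rfl⟩ := Finite.surjective_of_injective hinj k
  obtain ⟨i', hi'⟩ := hone' s
  obtain ⟨e1, e2⟩ := offset_inj (g (i s)).2 (g' i').2 ((hi s).symm.trans hi')
  rw [e2, Fin.ext e1]

end QSort

/-! ### Counting queries over the slices. -/

namespace QSort

variable {N S : ℕ}

theorem exists_append_countP {α : Type*} (p : α → Bool) (l : List α) {c : ℕ}
    (hc : c ≤ l.countP p) : ∃ l₁ l₂, l = l₁ ++ l₂ ∧ l₁.countP p = c := by
  induction l generalizing c with
  | nil => exact ⟨[], [], rfl, (Nat.le_zero.1 hc).symm⟩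
  | cons x l ih =>
    rcases c with _ | c
    · exact ⟨[], x :: l, rfl, rfl⟩
    by_cases hx : p x
    · rw [List.countP_cons_of_pos hx] at hc
      obtain ⟨l₁, l₂, rfl, h⟩ := ih (Nat.le_of_succ_le_succ hc)
      exact ⟨x :: l₁, l₂, rfl, by rw [List.countP_cons_of_pos hx, h]⟩
    · rw [List.countP_cons_of_neg hx] at hc
      obtain ⟨l₁, l₂, rfl, h⟩ := ih hc
      exact ⟨x :: l₁, l₂, rfl, by rw [List.countP_cons_of_neg hx, h]⟩

/-- If each of the first `B` consecutive blocks of `k` elements with the property `p` contains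
many elements with the property `q`, then there are many elements with this property. -/
theorem mul_le_countP_of_blocks {α : Type*} (p q : α → Bool) (l : List α) (k B : ℕ) (c : ℝ)
    (H : ∀ t < B, ∀ l₁ l₂ l₃, l = l₁ ++ (l₂ ++ l₃) → l₁.countP p = t * k → l₂.countP p = k →
      c ≤ l₂.countP q) (t : ℕ) (ht : t ≤ B) (l' l'' : List α) (hl : l = l' ++ l'')
    (hp : l'.countP p = t * k) : t * c ≤ l'.countP q := by
  induction t generalizing l' l'' with
  | zero => simp
  | succ t ih =>
    obtain ⟨l₁, l₂, rfl, h⟩ := exists_append_countP p l' (c := t * k)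
      (by rw [hp]; exact Nat.mul_le_mul_right _ t.le_succ)
    have h1 := ih (by omega) l₁ (l₂ ++ l'') (by rw [hl, List.append_assoc]) h
    rw [List.countP_append, h, add_mul, one_mul] at hp
    have h2 := H t (by omega) l₁ l₂ l'' (by rw [hl, List.append_assoc]) h (by omega)
    rw [List.countP_append]
    push_cast
    linarith

theorem outputs_eq_of_successProb_pos {C : Circuit N S} {f : Fin N → Fin 3}
    (h : 0 < C.successProb f) : C.outputs = N * width N := by
  by_contra hne
  refine h.ne' (Finset.sum_eq_zero fun o _ => if_neg ?_)
  rintro ⟨x, -, -, ho⟩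
  have := congrArg List.length ho
  rw [List.length_ofFn, length_encode] at this
  exact hne this

/-- Fixes `l = 8`, whence `1 / l² = 1 / 64` and `4 (l² - 1) = 252`. -/
theorem slice_queries {C : Circuit N S} (hC : ∀ f, 2 / 3 ≤ C.successProb f) {a K m : ℕ}
    (hm : 0 < m) (ha : a + K * m ≤ N) (g₁ g₂ g₃ : List (Gate N S))
    (hgates : C.gates = g₁ ++ (g₂ ++ g₃)) (h₁ : g₁.countP Gate.isOutput = a * width N)
    (h₂ : g₂.countP Gate.isOutput = K * width N) :
    2 / 3 ≤ (2 : ℝ) ^ S * ((1 / m + 1 / 64) ^ K * (1 + 252 / √m) ^ g₂.countP Gate.isOracle) := by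
  have : Nonempty (Fin m) := ⟨⟨0, hm⟩⟩
  have := slice_bound (isLocalFamily_hardInput (N := N) (a := a) (K := K) (m := m))
    (l := 8) (by norm_num) (fun g => IsSortingBlock a K (hardInput N a g))
    (IsSortingBlock.index_unique ha) hC g₁ g₂ g₃ hgates
    fun g o₁ o₂ o₃ ho₁ ho₂ h => IsSorting.block (ho₁.trans h₁) (ho₂.trans h₂) h
  norm_num at this ⊢
  exact this

theorem first_slice_queries {C : Circuit N S} (hC : ∀ f, 2 / 3 ≤ C.successProb f) {K m : ℕ}
    (hm : 0 < m) (hK : K * m ≤ N) (g₂ g₃ : List (Gate N S)) (hgates : C.gates = g₂ ++ g₃)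
    (h₂ : g₂.countP Gate.isOutput = K * width N) :
    2 / 3 ≤ ((1 / m + 1 / 64) ^ K * (1 + 252 / √m) ^ g₂.countP Gate.isOracle : ℝ) := by
  have : Nonempty (Fin m) := ⟨⟨0, hm⟩⟩
  have ha : 0 + K * m ≤ N := by omega
  have := first_slice_bound (isLocalFamily_hardInput (N := N) (a := 0) (K := K) (m := m))
    (l := 8) (by norm_num) (fun g => IsSortingBlock 0 K (hardInput N 0 g))
    (IsSortingBlock.index_unique ha) hC g₂ g₃ hgates
    fun g o₂ o₃ ho₂ h => IsSorting.block (o₁ := []) (by simp) (ho₂.trans h₂) h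
  norm_num at this ⊢
  exact this

/-- With fewer queries the query factor is at most `exp K ≤ 3 ^ K`, while `1 / m + 1 / 64 ≤ 1 / 32`;
the product is then at most `(3 / 16) ^ K < 2 / 3`. The factor `2 ^ K` leaves room for `2 ^ S` when
`S ≤ K`. -/
theorem lt_of_slice_bound {K m q : ℕ} (hK : 1 ≤ K) (hm : 64 ≤ m)
    (h : 2 / 3 ≤ (2 : ℝ) ^ K * ((1 / m + 1 / 64) ^ K * (1 + 252 / √m) ^ q)) :
    K * √m / 256 < q := by
  by_contra! hq
  have hm' : (64 : ℝ) ≤ m := by exact_mod_cast hm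
  have hs : 0 < √(m : ℝ) := Real.sqrt_pos.2 (by linarith)
  have h1 : (1 + 252 / √(m : ℝ)) ^ q ≤ 3 ^ K := by
    calc (1 + 252 / √(m : ℝ)) ^ q ≤ Real.exp (252 / √m) ^ q := by
          gcongr
          linarith [Real.add_one_le_exp (252 / √(m : ℝ))]
      _ = Real.exp (q * (252 / √m)) := by rw [Real.exp_nat_mul]
      _ ≤ Real.exp K := by
          gcongr
          calc (q : ℝ) * (252 / √m) ≤ K * √m / 256 * (252 / √m) := by gcongr
            _ = K * (252 / 256) := by field_simp
            _ ≤ K := mul_le_of_le_one_right (by positivity) (by norm_num)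
      _ = Real.exp 1 ^ K := by rw [← Real.exp_nat_mul, mul_one]
      _ ≤ 3 ^ K := by
          gcongr
          linarith [Real.exp_one_lt_d9]
  have h2 : (1 / m + 1 / 64 : ℝ) ≤ 1 / 32 := by
    have : 1 / (m : ℝ) ≤ 1 / 64 := by gcongr
    linarith
  have h3 : (2 : ℝ) ^ K * ((1 / m + 1 / 64) ^ K * (1 + 252 / √m) ^ q) ≤
      2 ^ K * ((1 / 32) ^ K * 3 ^ K) := by gcongr
  rw [← mul_pow, ← mul_pow] at h3
  have h4 : (2 * (1 / 32 * 3) : ℝ) ^ K ≤ 2 * (1 / 32 * 3) :=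
    pow_le_of_le_one (by norm_num) (by norm_num) (by omega)
  linarith

theorem one_le_queries (hN : 2 ≤ N) {C : Circuit N S} (hC : ∀ f, 2 / 3 ≤ C.successProb f) :
    1 ≤ C.queries := by
  have hout := outputs_eq_of_successProb_pos
    ((by norm_num : (0 : ℝ) < 2 / 3).trans_le (hC fun _ => 0))
  obtain ⟨g₂, g₃, hg, h₂⟩ := exists_append_countP Gate.isOutput C.gates (c := 1 * width N)
    (by rw [Circuit.outputs] at hout; rw [hout]; exact Nat.mul_le_mul_right _ (by omega))
  -- Without queries the bound would read `2 / 3 ≤ 1 / 2 + 1 / 64`.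
  have h := first_slice_queries hC (K := 1) (m := 2) (by norm_num) (by omega) g₂ g₃ hg h₂
  by_contra hq
  have hq0 : g₂.countP Gate.isOracle = 0 := by
    rw [Circuit.queries, hg, List.countP_append] at hq
    omega
  rw [hq0] at h
  norm_num at h

theorem one_le_space {C : Circuit N S} (hq : 1 ≤ C.queries) : 1 ≤ S := by
  obtain ⟨g, -, hg⟩ := List.countP_pos_iff.1 (Nat.lt_of_succ_le hq)
  cases g with
  | oracle reg => exact Nat.succ_le_of_lt ((Nat.zero_le _).trans_lt (reg (Sum.inr 0)).2)
  | channel k K hK => cases hg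
  | output K hK => cases hg

/-- There are `m` slices of `S + 1` elements each. Half of `2 (S + 1) m` pays for the points of
value `2` that shift the marked points to the ranks of a slice, the other half for the groups. -/
theorem queries_ge_of_small_space {C : Circuit N S} (hC : ∀ f, 2 / 3 ≤ C.successProb f)
    {m : ℕ} (hm : 64 ≤ m) (hmN : 2 * (S + 1) * m ≤ N) :
    m * ((S + 1 : ℕ) * √m / 256) ≤ (C.queries : ℝ) := by
  have hout := outputs_eq_of_successProb_pos
    ((by norm_num : (0 : ℝ) < 2 / 3).trans_le (hC fun _ => 0))
  have hmN' : m * (S + 1) + (S + 1) * m ≤ N := by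
    calc m * (S + 1) + (S + 1) * m = 2 * (S + 1) * m := by ring
      _ ≤ N := hmN
  obtain ⟨g, g', hg, hp⟩ := exists_append_countP Gate.isOutput C.gates
    (c := m * ((S + 1) * width N)) (by
      rw [Circuit.outputs] at hout
      rw [hout, ← mul_assoc]
      exact Nat.mul_le_mul_right _ (by omega))
  have h := mul_le_countP_of_blocks Gate.isOutput Gate.isOracle C.gates
    ((S + 1) * width N) m ((S + 1 : ℕ) * √m / 256) (fun t ht g₁ g₂ g₃ hgs h₁ h₂ => by
      refine (lt_of_slice_bound (by omega) hm ?_).le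
      have htm : t * (S + 1) ≤ m * (S + 1) := Nat.mul_le_mul_right _ ht.le
      refine (slice_queries hC (a := t * (S + 1)) (K := S + 1) (m := m) (by omega)
        (by omega) g₁ g₂ g₃ hgs
        (by rw [h₁, mul_assoc]) h₂).trans
        (mul_le_mul_of_nonneg_right ?_ (by positivity))
      exact pow_le_pow_right₀ (by norm_num) S.le_succ) m le_rfl g g' hg hp
  refine h.trans ?_
  rw [Circuit.queries, hg, List.countP_append]
  push_cast
  linarith [(Nat.cast_nonneg (g'.countP Gate.isOracle) : (0 : ℝ) ≤ _)]

/-- Groups of constant size `64` suffice, because the first slice loses no factor `2 ^ S` and may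
thus be taken of length linear in `N`. -/
theorem queries_gt_of_large_input {C : Circuit N S} (hC : ∀ f, 2 / 3 ≤ C.successProb f)
    (hN : 64 ≤ N) : (N / 64 : ℕ) / 32 < (C.queries : ℝ) := by
  have hout := outputs_eq_of_successProb_pos
    ((by norm_num : (0 : ℝ) < 2 / 3).trans_le (hC fun _ => 0))
  have hK : N / 64 * 64 ≤ N := Nat.div_mul_le_self N 64
  have hK1 : 1 ≤ N / 64 := by omega
  obtain ⟨g₂, g₃, hg, h₂⟩ := exists_append_countP Gate.isOutput C.gates
    (c := N / 64 * width N)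
    (by rw [Circuit.outputs] at hout; rw [hout]; exact Nat.mul_le_mul_right _ (by omega))
  have h := first_slice_queries hC (by norm_num) hK g₂ g₃ hg h₂
  have hlt := lt_of_slice_bound hK1 le_rfl (h.trans (le_mul_of_one_le_left (by positivity)
    (one_le_pow₀ (by norm_num))))
  have h8 : √((64 : ℕ) : ℝ) = 8 := by
    rw [show ((64 : ℕ) : ℝ) = 8 ^ 2 by norm_num]
    exact Real.sqrt_sq (by norm_num)
  rw [h8] at hlt
  have hle : (g₂.countP Gate.isOracle : ℝ) ≤ C.queries := by
    rw [Circuit.queries, hg, List.countP_append]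
    push_cast
    linarith [(Nat.cast_nonneg (g₃.countP Gate.isOracle) : (0 : ℝ) ≤ _)]
  linarith

theorem cube_le_queries_sq_mul_space (hN : 2 ≤ N) {C : Circuit N S}
    (hC : ∀ f, 2 / 3 ≤ C.successProb f) :
    (N : ℝ) ^ 3 ≤ 2 ^ 32 * ((C.queries : ℝ) ^ 2 * S) := by
  have hQ := one_le_queries hN hC
  have hS : (1 : ℝ) ≤ S := by exact_mod_cast one_le_space hQ
  have hQ : (1 : ℝ) ≤ C.queries := by exact_mod_cast hQ
  set Q : ℝ := (C.queries : ℝ)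
  -- The threshold is what makes the group size `N / (2 (S + 1))` at least `64`.
  rcases le_or_gt (128 * (S + 1)) N with h | h
  · set m := N / (2 * (S + 1)) with hmdef
    have hm : 64 ≤ m := by rw [hmdef, Nat.le_div_iff_mul_le (by omega)]; omega
    have hq := queries_ge_of_small_space hC hm (Nat.mul_div_le _ _)
    have hNm : N ≤ 4 * (S + 1) * m := by
      have := Nat.lt_mul_div_succ N (show 0 < 2 * (S + 1) by omega)
      rw [← hmdef] at this
      nlinarith
    have hNm' : (N : ℝ) ≤ 4 * (S + 1) * m := by exact_mod_cast hNm
    push_cast at hq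
    have hsq : ((m : ℝ) * ((S + 1) * √m / 256)) ^ 2 ≤ Q ^ 2 := by gcongr
    have e : ((m : ℝ) * ((S + 1) * √m / 256)) ^ 2 = m ^ 3 * (S + 1) ^ 2 / 2 ^ 16 := by
      rw [mul_pow, div_pow, mul_pow, Real.sq_sqrt (by positivity)]
      ring
    rw [e] at hsq
    calc (N : ℝ) ^ 3 ≤ (4 * (S + 1) * m) ^ 3 := by gcongr
      _ = 2 ^ 22 * ((m : ℝ) ^ 3 * (S + 1) ^ 2 / 2 ^ 16) * (S + 1) := by ring
      _ ≤ 2 ^ 22 * Q ^ 2 * (2 * S) := by gcongr; linarith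
      _ = 2 ^ 23 * (Q ^ 2 * S) := by ring
      _ ≤ 2 ^ 32 * (Q ^ 2 * S) := by gcongr <;> norm_num
  · have hNS : (N : ℝ) ≤ 2 ^ 8 * S := by
      have : (N : ℝ) < 128 * (S + 1) := by exact_mod_cast h
      linarith
    rcases le_or_gt 64 N with h64 | h64
    · have hq := queries_gt_of_large_input hC h64
      have hNK : N ≤ 128 * (N / 64) := by omega
      have hNK' : (N : ℝ) ≤ 128 * (N / 64 : ℕ) := by exact_mod_cast hNK
      have hNQ : (N : ℝ) ≤ 2 ^ 12 * Q := by linarith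
      calc (N : ℝ) ^ 3 = N ^ 2 * N := by ring
        -- This case of large space determines the final constant `2 ^ 32`.
        _ ≤ (2 ^ 12 * Q) ^ 2 * (2 ^ 8 * S) := by gcongr
        _ = 2 ^ 32 * (Q ^ 2 * S) := by ring
    · have hN64 : (N : ℝ) ≤ 64 := by exact_mod_cast h64.le
      have h1 : 1 ≤ Q ^ 2 * S := one_le_mul_of_one_le_of_one_le (one_le_pow₀ hQ) hS
      calc (N : ℝ) ^ 3 ≤ 64 ^ 3 := by gcongr
        _ ≤ 2 ^ 32 * 1 := by norm_num
        _ ≤ 2 ^ 32 * (Q ^ 2 * S) := by gcongr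

end QSort

theorem theorem6p7 :
    ∃ c : ℝ, 0 < c ∧
      ∀ (N S : ℕ), 2 ≤ N → ∀ C : QSort.Circuit N S,
        (∀ f : Fin N → Fin 3, 2 / 3 ≤ C.successProb f) →
          c * (N : ℝ) ^ 3 ≤ (C.queries : ℝ) ^ 2 * (S : ℝ) ∧
          c * (N : ℝ) ^ 3 ≤ (C.time : ℝ) ^ 2 * (S : ℝ) := by
  refine ⟨1 / 2 ^ 32, by positivity, fun N S hN C hC => ?_⟩
  have h := QSort.cube_le_queries_sq_mul_space hN hC
  have hle : (C.queries : ℝ) ≤ C.time := by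
    exact_mod_cast List.countP_le_length
  have h1 : 1 / 2 ^ 32 * (N : ℝ) ^ 3 ≤ (C.queries : ℝ) ^ 2 * S := by linarith
  exact ⟨h1, h1.trans (by gcongr)⟩
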